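/- For complex numbers $a,q$ with $|q|<1$ let $(a;q)_\infty:=\prod_{k=0}^{\infty}(1-aq^k)$ and $\chi(q):=(-q;q^2)_\infty$. For a positive rational number $n$ the class invariant $G_n$ is defined by $$G_n:=2^{-1/4}q^{-1/24}\chi(q),\qquad q=e^{-\pi\sqrt{n}}.$$ Then $$G_{625} = \frac{11 + 5\sqrt{5}}{4}\left(\frac{\tan^2 \frac{\pi}{5}}{\sqrt{5}}\left\{1 + \left(8\left(3\cos\tfrac{\pi}{5} + \sin\tfrac{\pi}{5}\right)\right)^{1/5} + \left(8\left(3\cos\tfrac{\pi}{5} - \sin\tfrac{\pi}{5}\right)\right)^{1/5}\right\}^2 - 1\right),$$ where all roots are the positive real ones. -/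

import Mathlib

noncomputable section

/-- The `q`-shifted factorial `(a; q)_∞ = ∏_{k ≥ 0} (1 - a q^k)`, for `|q| < 1`. -/
def qShiftedFactorial (a q : ℂ) : ℂ := ∏' k : ℕ, (1 - a * q ^ k)

/-- The product defining `(a; q)_∞` converges (absolutely) whenever `|q| < 1`. -/
theorem multipliable_qShiftedFactorial (a q : ℂ) (hq : ‖q‖ < 1) :
    Multipliable (fun k : ℕ => 1 - a * q ^ k) := by
  have h : Summable (fun k : ℕ => ‖-(a * q ^ k)‖) := by
    simp only [norm_neg, norm_mul, norm_pow]
    exact (summable_geometric_of_lt_one (norm_nonneg q) hq).mul_left _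
  simpa [sub_eq_add_neg] using multipliable_one_add_of_summable h

/-- Ramanujan's function `χ(q) = (-q; q²)_∞`, for `|q| < 1`. -/
def ramanujanChi (q : ℂ) : ℂ := qShiftedFactorial (-q) (q ^ 2)

/-- The class invariant `G_n = 2^(-1/4) q^(-1/24) χ(q)` with `q = exp (-π √n)`, for a positive
rational number `n`. The powers are real powers of positive real numbers. -/
def classInvariantG (n : ℚ) : ℂ :=
  (((2 : ℝ) ^ (-(1 / 4) : ℝ) * Real.exp (-Real.pi * √(n : ℝ)) ^ (-(1 / 24) : ℝ) : ℝ) : ℂ) *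
    ramanujanChi ((Real.exp (-Real.pi * √(n : ℝ)) : ℝ) : ℂ)

end

/-! ### Infinite q-products -/

open Filter Topology

/-! The number 625 is reached from 1 by two steps of degree five. With u = G_n and v = G_{25n}, the
modular equation is u⁶ + v⁶ = 2(u⁵v⁵ - uv). Theta inversion gives G_1 = 1, one step gives G_25 = φ
(the golden ratio), and a second step makes G_625 a root of a sextic over ℚ(φ). Removing the root 1
leaves a quintic with a single positive root, so it suffices that the closed form is positive and
satisfies this quintic.

The modular equation (`ramanujanChi_modular_equation_five`) comes from splitting ℤ² along an index-5
sublattice on which x² + y² becomes 5(y² + n²). Applied to products of theta series with ω = 1 and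
with ω a primitive fifth root of unity (`thetaSeries_mul_eq`), and turned into products by the
Jacobi triple product (`thetaSeries_eq`), this gives two relations between χ(q) and χ(q⁵), from
which the remaining infinite products cancel.

The closed form works because the quintic in w becomes solvable after writing w as a quadratic in S
(`quintic_substitution`), where S = A + B is a sum of two fifth roots with AB = 2φ and A⁵ + B⁵ =
24φ. -/

theorem tendsto_prod_qShiftedFactorial (a : ℂ) {q : ℂ} (hq : ‖q‖ < 1) :
    Tendsto (fun n : ℕ => ∏ k ∈ Finset.range n, (1 - a * q ^ k)) atTop
      (𝓝 (qShiftedFactorial a q)) :=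
  (multipliable_qShiftedFactorial a q hq).hasProd.tendsto_prod_nat

theorem qShiftedFactorial_ne_zero {a q : ℂ} (hq : ‖q‖ < 1) (h : ∀ k : ℕ, a * q ^ k ≠ 1) :
    qShiftedFactorial a q ≠ 0 := by
  have := tprod_one_add_ne_zero_of_summable (f := fun k : ℕ => -(a * q ^ k)) (fun k => by
    rw [← sub_eq_add_neg]; exact sub_ne_zero.2 (h k).symm) (by
    simp only [norm_neg, norm_mul, norm_pow]
    exact (summable_geometric_of_lt_one (norm_nonneg q) hq).mul_left _)
  simpa [qShiftedFactorial, sub_eq_add_neg] using this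

theorem qShiftedFactorial_ne_zero_of_norm_lt_one {a q : ℂ} (hq : ‖q‖ < 1) (ha : ‖a‖ < 1) :
    qShiftedFactorial a q ≠ 0 := by
  refine qShiftedFactorial_ne_zero hq fun k hk => ?_
  have h : ‖a * q ^ k‖ < 1 := by
    rw [norm_mul, norm_pow]
    calc ‖a‖ * ‖q‖ ^ k ≤ ‖a‖ * 1 := by
          gcongr; exact pow_le_one₀ (norm_nonneg _) hq.le
      _ < 1 := by simpa using ha
  rw [hk] at h
  simp at h

theorem qShiftedFactorial_eq_mul (a : ℂ) {q : ℂ} (hq : ‖q‖ < 1) :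
    qShiftedFactorial a q = (1 - a) * qShiftedFactorial (a * q) q := by
  have h1 := (tendsto_prod_qShiftedFactorial a hq).comp (tendsto_add_atTop_nat 1)
  have h2 := (tendsto_prod_qShiftedFactorial (a * q) hq).const_mul (1 - a)
  refine tendsto_nhds_unique h1 (h2.congr fun n => ?_)
  simp [Finset.prod_range_succ', pow_succ', mul_comm, mul_assoc]

theorem prod_range_mul_eq_prod_prod (f : ℕ → ℂ) (m n : ℕ) :
    ∏ k ∈ Finset.range (m * n), f k =
      ∏ r ∈ Finset.range m, ∏ k ∈ Finset.range n, f (r + m * k) := by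
  induction n with
  | zero => simp
  | succ n ih =>
    simp only [Nat.mul_succ, Finset.prod_range_add, ih, Finset.prod_range_succ,
      Finset.prod_mul_distrib]
    simp [add_comm]

/-- Dissection of `(a; q)_∞` according to the residue of the index modulo `m`. -/
theorem qShiftedFactorial_dissection (a : ℂ) {q : ℂ} (hq : ‖q‖ < 1) {m : ℕ} (hm : 0 < m) :
    qShiftedFactorial a q = ∏ r ∈ Finset.range m, qShiftedFactorial (a * q ^ r) (q ^ m) := by
  have hqm : ‖q ^ m‖ < 1 := by
    rw [norm_pow]; exact pow_lt_one₀ (norm_nonneg _) hq hm.ne'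
  have h1 := (tendsto_prod_qShiftedFactorial a hq).comp
    (tendsto_id.const_mul_atTop' hm : Tendsto (fun n : ℕ => m * id n) atTop atTop)
  refine tendsto_nhds_unique h1 ((tendsto_finsetProd (Finset.range m) fun r _ =>
    tendsto_prod_qShiftedFactorial (a * q ^ r) hqm).congr fun n => ?_)
  simp [prod_range_mul_eq_prod_prod, pow_add, pow_mul, mul_assoc]

/-- The product of the factorials `(ω a; q)_∞` over the `m`-th roots of unity. -/
theorem prod_qShiftedFactorial_rootsOfUnity {ζ : ℂ} {m : ℕ} (hζ : IsPrimitiveRoot ζ m)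
    (hm : 0 < m) (a : ℂ) {q : ℂ} (hq : ‖q‖ < 1) :
    ∏ r ∈ Finset.range m, qShiftedFactorial (ζ ^ r * a) q = qShiftedFactorial (a ^ m) (q ^ m) := by
  have hqm : ‖q ^ m‖ < 1 := by
    rw [norm_pow]; exact pow_lt_one₀ (norm_nonneg _) hq hm.ne'
  refine tendsto_nhds_unique ((tendsto_finsetProd (Finset.range m) fun r _ =>
    tendsto_prod_qShiftedFactorial (ζ ^ r * a) hq))
    ((tendsto_prod_qShiftedFactorial (a ^ m) hqm).congr fun n => ?_)
  rw [Finset.prod_comm]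
  refine Finset.prod_congr rfl fun k _ => ?_
  have : NeZero m := ⟨hm.ne'⟩
  have h := hζ.pow_sub_pow_eq_prod_sub_mul 1 (a * q ^ k) hm
  rw [one_pow, mul_pow, ← pow_mul, mul_comm k m, pow_mul] at h
  rw [h]
  refine (Finset.prod_nbij (fun r => ζ ^ r) (fun r _ => ?_) (fun r hr s hs h => ?_)
    (fun x hx => ?_) (fun r _ => by rw [mul_assoc])).symm
  · rw [Polynomial.mem_nthRootsFinset hm, ← pow_mul, mul_comm, pow_mul, hζ.pow_eq_one, one_pow]
  · exact hζ.pow_inj (Finset.mem_range.1 hr) (Finset.mem_range.1 hs) h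
  · obtain ⟨i, hi, rfl⟩ := hζ.eq_pow_of_pow_eq_one
      ((Polynomial.mem_nthRootsFinset hm _).1 (Finset.mem_coe.1 hx))
    exact ⟨i, Finset.mem_coe.2 (Finset.mem_range.2 hi), rfl⟩

/-! ### Theta series and the Jacobi triple product -/

/-- The theta series `∑ q^(k²) z^k` over the integers `k`. -/
noncomputable def thetaSeries (z q : ℂ) : ℂ := ∑' k : ℤ, q ^ (k ^ 2) * z ^ k

theorem summable_thetaSeries {z q : ℂ} (hz : z ≠ 0) (hq0 : q ≠ 0) (hq : ‖q‖ < 1) :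
    Summable fun k : ℤ => q ^ (k ^ 2) * z ^ k := by
  have hpi : (Real.pi : ℂ) ≠ 0 := by exact_mod_cast Real.pi_ne_zero
  have him : 0 < (Complex.log q / (Real.pi * Complex.I)).im := by
    have : Complex.log q / (Real.pi * Complex.I) =
        ((1 / Real.pi : ℝ) : ℂ) * (-Complex.I * Complex.log q) := by
      push_cast; field_simp; simp
    rw [this, Complex.im_ofReal_mul]
    have hl : Real.log ‖q‖ < 0 := Real.log_neg (norm_pos_iff.2 hq0) hq
    have : (-Complex.I * Complex.log q).im = - Real.log ‖q‖ := by simp [Complex.log_re]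
    rw [this]
    exact mul_pos (by positivity) (by linarith)
  refine ((summable_jacobiTheta₂_term_iff (Complex.log z / (2 * Real.pi * Complex.I)) _).2
    him).congr fun k => ?_
  rw [jacobiTheta₂_term, Complex.exp_add, mul_comm]
  congr 1
  · rw [show (Real.pi : ℂ) * Complex.I * k ^ 2 * (Complex.log q / (Real.pi * Complex.I)) =
      ((k ^ 2 : ℤ) : ℂ) * Complex.log q by push_cast; field_simp, Complex.exp_int_mul,
      Complex.exp_log hq0]
  · rw [show 2 * (Real.pi : ℂ) * Complex.I * k * (Complex.log z / (2 * Real.pi * Complex.I)) =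
      (k : ℂ) * Complex.log z by field_simp, Complex.exp_int_mul, Complex.exp_log hz]

/-- The reciprocal of `(q; q)_m`, extended by zero to negative `m`. -/
noncomputable def invQFactorial (q : ℂ) (m : ℤ) : ℂ :=
  if 0 ≤ m then (∏ k ∈ Finset.range m.toNat, (1 - q * q ^ k))⁻¹ else 0

theorem mul_pow_ne_one {q : ℂ} (hq : ‖q‖ < 1) (k : ℕ) : q * q ^ k ≠ 1 := by
  intro h
  have h2 : ‖q ^ (k + 1)‖ < 1 := by
    rw [norm_pow]; exact pow_lt_one₀ (norm_nonneg _) hq (by simp)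
  rw [pow_succ', h] at h2
  simp at h2

/-- Extension by zero fits the recurrence at `m = 0` because `1 - q ^ 0` vanishes, so no index is
exceptional. -/
theorem invQFactorial_sub_one {q : ℂ} (hq : ‖q‖ < 1) (m : ℤ) :
    invQFactorial q (m - 1) = (1 - q ^ m) * invQFactorial q m := by
  rcases lt_trichotomy m 0 with h | h | h
  · simp [invQFactorial, show ¬ (0 ≤ m) by omega, show ¬ (1 ≤ m) by omega]
  · simp [invQFactorial, h]
  · obtain ⟨n, rfl⟩ : ∃ n : ℕ, m = n + 1 := ⟨(m - 1).toNat, by omega⟩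
    have hn : (((n : ℤ) + 1)).toNat = n + 1 := by omega
    have hn0 : (0 : ℤ) ≤ n + 1 := by omega
    have h1 : 1 - q * q ^ n ≠ 0 := sub_ne_zero.2 (mul_pow_ne_one hq n).symm
    have h2 : q ^ ((n : ℤ) + 1) = q * q ^ n := by
      rw [← pow_succ']; exact_mod_cast zpow_natCast q (n + 1)
    simp only [invQFactorial, add_sub_cancel_right, Int.natCast_nonneg, hn0, if_true, hn,
      Int.toNat_natCast, Finset.prod_range_succ, h2, mul_inv]
    field_simp

/-- The finite form of the Jacobi triple product. -/
theorem hasSum_finite_tripleProduct {z q : ℂ} (hz : z ≠ 0) (hq0 : q ≠ 0) (hq : ‖q‖ < 1) (n : ℕ) :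
    HasSum (fun k : ℤ => q ^ (k ^ 2) * z ^ k *
      ((∏ j ∈ Finset.range (2 * n), (1 - q ^ 2 * (q ^ 2) ^ j)) *
        invQFactorial (q ^ 2) (n + k) * invQFactorial (q ^ 2) (n - k)))
      (∏ j ∈ Finset.range n, ((1 + z * q * (q ^ 2) ^ j) * (1 + z⁻¹ * q * (q ^ 2) ^ j))) := by
  have hq2 : ‖q ^ 2‖ < 1 := by
    rw [norm_pow]; exact pow_lt_one₀ (norm_nonneg _) hq (by simp)
  induction n with
  | zero =>
    have := hasSum_single (f := fun k : ℤ => q ^ (k ^ 2) * z ^ k *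
      ((∏ j ∈ Finset.range (2 * 0), (1 - q ^ 2 * (q ^ 2) ^ j)) *
        invQFactorial (q ^ 2) ((0 : ℕ) + k) * invQFactorial (q ^ 2) ((0 : ℕ) - k))) 0 (by
      intro k hk
      rcases lt_or_gt_of_ne hk with h | h
      · simp [invQFactorial, show ¬ (0 ≤ k) by omega]
      · simp [invQFactorial, show ¬ (k ≤ 0) by omega])
    simpa [invQFactorial] using this
  | succ n ih =>
    have e1 := (Equiv.subRight (1 : ℤ)).hasSum_iff.2 ih
    have e2 := (Equiv.addRight (1 : ℤ)).hasSum_iff.2 ih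
    -- The new factor (1 + zq^(2n+1))(1 + z⁻¹q^(2n+1)) expands into a constant, a multiple of z and
    -- a multiple of z⁻¹; the last two shift the summation index by one. Comparing coefficients
    -- leaves a q-Pascal identity.
    have e := ((ih.mul_left (1 + q ^ (4 * n + 2))).add ((e1.mul_left (q ^ (2 * n + 1) * z)).add
      (e2.mul_left (q ^ (2 * n + 1) * z⁻¹))))
    have hval : ∀ x : ℂ, (1 + q ^ (4 * n + 2)) * x +
        (q ^ (2 * n + 1) * z * x + q ^ (2 * n + 1) * z⁻¹ * x) =
        x * ((1 + z * q * (q ^ 2) ^ n) * (1 + z⁻¹ * q * (q ^ 2) ^ n)) := by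
      intro x
      have e4 : q ^ (4 * n + 2) = ((q ^ 2) ^ n) ^ 2 * q ^ 2 := by ring
      have e7 : q ^ (2 * n + 1) = (q ^ 2) ^ n * q := by ring
      rw [e4, e7]
      field_simp
      ring
    rw [hval, ← Finset.prod_range_succ (fun j => (1 + z * q * (q ^ 2) ^ j) *
      (1 + z⁻¹ * q * (q ^ 2) ^ j))] at e
    refine e.congr_fun fun k => ?_
    simp only [Function.comp, Equiv.subRight_apply, Equiv.coe_addRight]
    have a1 : invQFactorial (q ^ 2) (n + k) = (1 - (q ^ 2) ^ ((n : ℤ) + 1 + k)) *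
        invQFactorial (q ^ 2) (n + 1 + k) := by
      rw [← invQFactorial_sub_one hq2]; ring_nf
    have a2 : invQFactorial (q ^ 2) (n - k) = (1 - (q ^ 2) ^ ((n : ℤ) + 1 - k)) *
        invQFactorial (q ^ 2) (n + 1 - k) := by
      rw [← invQFactorial_sub_one hq2]; ring_nf
    have a3 : invQFactorial (q ^ 2) (n + (k - 1)) = (1 - (q ^ 2) ^ ((n : ℤ) + k)) *
        invQFactorial (q ^ 2) (n + k) := by
      rw [← invQFactorial_sub_one hq2]; ring_nf
    have a4 : invQFactorial (q ^ 2) (n - (k + 1)) = (1 - (q ^ 2) ^ ((n : ℤ) - k)) *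
        invQFactorial (q ^ 2) (n - k) := by
      rw [← invQFactorial_sub_one hq2]; ring_nf
    have a5 : invQFactorial (q ^ 2) (n - (k - 1)) = invQFactorial (q ^ 2) (n + 1 - k) := by
      ring_nf
    have a6 : invQFactorial (q ^ 2) (n + (k + 1)) = invQFactorial (q ^ 2) (n + 1 + k) := by
      ring_nf
    rw [a3, a4, a5, a6, a1, a2]
    push_cast
    set A := invQFactorial (q ^ 2) (n + 1 + k)
    set B := invQFactorial (q ^ 2) (n + 1 - k)
    rw [show 2 * (n + 1) = 2 * n + 1 + 1 by ring, Finset.prod_range_succ, Finset.prod_range_succ]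
    set P := ∏ j ∈ Finset.range (2 * n), (1 - q ^ 2 * (q ^ 2) ^ j)
    have hq2' : q ^ 2 ≠ 0 := pow_ne_zero 2 hq0
    have x1 : (q ^ 2) ^ ((n : ℤ) + k) = q ^ (2 * n) * (q ^ k) ^ 2 := by
      rw [zpow_add₀ hq2', zpow_natCast, ← pow_mul, ← zpow_natCast q 2, zpow_comm]; simp
    have x2 : (q ^ 2) ^ ((n : ℤ) - k) = q ^ (2 * n) * ((q ^ k)⁻¹) ^ 2 := by
      rw [zpow_sub₀ hq2', zpow_natCast, ← pow_mul, ← zpow_natCast q 2, zpow_comm]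
      simp [div_eq_mul_inv]
    have x3 : (q ^ 2) ^ ((n : ℤ) + 1 + k) = q ^ 2 * (q ^ (2 * n) * (q ^ k) ^ 2) := by
      rw [← x1, ← zpow_one_add₀ hq2']; ring_nf
    have x4 : (q ^ 2) ^ ((n : ℤ) + 1 - k) = q ^ 2 * (q ^ (2 * n) * ((q ^ k)⁻¹) ^ 2) := by
      rw [← x2, ← zpow_one_add₀ hq2']; ring_nf
    have x5 : q ^ ((k - 1) ^ 2) = q ^ (k ^ 2) * ((q ^ k)⁻¹) ^ 2 * q := by
      rw [show (k - 1) ^ 2 = k ^ 2 + -k * 2 + 1 by ring, zpow_add₀ hq0, zpow_add₀ hq0, zpow_mul]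
      simp
    have x6 : q ^ ((k + 1) ^ 2) = q ^ (k ^ 2) * (q ^ k) ^ 2 * q := by
      rw [show (k + 1) ^ 2 = k ^ 2 + k * 2 + 1 by ring, zpow_add₀ hq0, zpow_add₀ hq0, zpow_mul]
      simp
    rw [x1, x2, x3, x4, x5, x6, zpow_sub_one₀ hz, zpow_add_one₀ hz]
    have hy : q ^ k ≠ 0 := zpow_ne_zero _ hq0
    generalize q ^ k = y at hy ⊢
    have e4 : q ^ (4 * n + 2) = (q ^ (2 * n)) ^ 2 * q ^ 2 := by ring
    have e5 : (q ^ 2) ^ (2 * n) = (q ^ (2 * n)) ^ 2 := by ring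
    have e6 : (q ^ 2) ^ (2 * n + 1) = (q ^ (2 * n)) ^ 2 * q ^ 2 := by ring
    have e7 : q ^ (2 * n + 1) = q ^ (2 * n) * q := by ring
    rw [e4, e5, e6, e7]
    generalize q ^ (2 * n) = w
    field_simp
    ring

theorem tendsto_invQFactorial {q : ℂ} (hq : ‖q‖ < 1) :
    Tendsto (invQFactorial q) atTop (𝓝 (qShiftedFactorial q q)⁻¹) := by
  have h := ((tendsto_prod_qShiftedFactorial q hq).comp
    (tendsto_atTop_atTop.2 fun b => ⟨b, fun a _ => by omega⟩ : Tendsto Int.toNat atTop atTop)).inv₀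
    (qShiftedFactorial_ne_zero_of_norm_lt_one hq hq)
  refine h.congr' ?_
  filter_upwards [eventually_ge_atTop 0] with m hm
  simp [invQFactorial, hm]

theorem exists_norm_invQFactorial_le {q : ℂ} (hq : ‖q‖ < 1) :
    ∃ C : ℝ, ∀ m, ‖invQFactorial q m‖ ≤ C := by
  have h : Tendsto (fun n : ℕ => invQFactorial q n) atTop (𝓝 (qShiftedFactorial q q)⁻¹) :=
    (tendsto_invQFactorial hq).comp tendsto_natCast_atTop_atTop
  obtain ⟨C, hC⟩ := h.norm.bddAbove_range
  have hC' : ∀ n : ℕ, ‖invQFactorial q n‖ ≤ C := fun n => hC ⟨n, rfl⟩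
  refine ⟨C, fun m => ?_⟩
  rcases le_or_gt 0 m with hm | hm
  · simpa [hm] using hC' m.toNat
  · rw [invQFactorial, if_neg (by omega), norm_zero]
    exact (norm_nonneg _).trans (hC' 0)

/-- The Jacobi triple product. -/
theorem thetaSeries_eq {z q : ℂ} (hz : z ≠ 0) (hq0 : q ≠ 0) (hq : ‖q‖ < 1) :
    thetaSeries z q = qShiftedFactorial (q ^ 2) (q ^ 2) *
      (qShiftedFactorial (-(z * q)) (q ^ 2) * qShiftedFactorial (-(z⁻¹ * q)) (q ^ 2)) := by
  have hq2 : ‖q ^ 2‖ < 1 := by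
    rw [norm_pow]; exact pow_lt_one₀ (norm_nonneg _) hq (by simp)
  set E := qShiftedFactorial (q ^ 2) (q ^ 2) with hE
  have hE0 : E ≠ 0 := qShiftedFactorial_ne_zero_of_norm_lt_one hq2 hq2
  have hP : Tendsto (fun n : ℕ => ∏ j ∈ Finset.range (2 * n), (1 - q ^ 2 * (q ^ 2) ^ j)) atTop
      (𝓝 E) := (tendsto_prod_qShiftedFactorial (q ^ 2) hq2).comp
        (tendsto_id.const_mul_atTop' two_pos : Tendsto (fun n : ℕ => 2 * id n) atTop atTop)
  obtain ⟨C, hC⟩ := exists_norm_invQFactorial_le hq2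
  obtain ⟨M, hM⟩ := hP.norm.bddAbove_range
  have hM' : ∀ n : ℕ, ‖∏ j ∈ Finset.range (2 * n), (1 - q ^ 2 * (q ^ 2) ^ j)‖ ≤ M :=
    fun n => hM ⟨n, rfl⟩
  have hC0 : 0 ≤ C := (norm_nonneg _).trans (hC 0)
  have hM0 : 0 ≤ M := (norm_nonneg _).trans (hM' 0)
  -- Let n → ∞ in the finite form: the q-binomial coefficients are bounded uniformly in n and k, and
  -- each tends to 1/E.
  have key := tendsto_tsum_of_dominated_convergence (𝓕 := atTop)
    (f := fun (n : ℕ) (k : ℤ) => q ^ (k ^ 2) * z ^ k *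
      ((∏ j ∈ Finset.range (2 * n), (1 - q ^ 2 * (q ^ 2) ^ j)) *
        invQFactorial (q ^ 2) (n + k) * invQFactorial (q ^ 2) (n - k)))
    (g := fun k : ℤ => q ^ (k ^ 2) * z ^ k * (E * E⁻¹ * E⁻¹))
    (bound := fun k : ℤ => ‖q ^ (k ^ 2) * z ^ k‖ * (M * C * C))
    ((summable_thetaSeries hz hq0 hq).norm.mul_right _)
    (fun k => by
      have t1 : Tendsto (fun n : ℕ => (n : ℤ) + k) atTop atTop :=
        tendsto_atTop_add_const_right _ _ tendsto_natCast_atTop_atTop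
      have t2 : Tendsto (fun n : ℕ => (n : ℤ) - k) atTop atTop :=
        tendsto_atTop_add_const_right _ (-k) tendsto_natCast_atTop_atTop
      exact ((hP.mul ((tendsto_invQFactorial hq2).comp t1)).mul
        ((tendsto_invQFactorial hq2).comp t2)).const_mul _)
    (Eventually.of_forall fun n k => by
      rw [norm_mul, norm_mul _ (invQFactorial _ _), norm_mul _ (invQFactorial _ _)]
      gcongr
      · exact hM' n
      · exact hC _
      · exact hC _)
  have lim := ((tendsto_prod_qShiftedFactorial (-(z * q)) hq2).mul
    (tendsto_prod_qShiftedFactorial (-(z⁻¹ * q)) hq2))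
  have := tendsto_nhds_unique key (lim.congr fun n => by
    rw [(hasSum_finite_tripleProduct hz hq0 hq n).tsum_eq, ← Finset.prod_mul_distrib]
    simp)
  rw [tsum_mul_right] at this
  rw [thetaSeries, ← this]
  field_simp

/-- Substitute k ↦ m - k; this merges the inversion z ↦ z⁻¹ with the quasi-periodicity under z ↦
q²z. -/
theorem thetaSeries_reflect {z q : ℂ} (hz : z ≠ 0) (hq0 : q ≠ 0) (m : ℤ) :
    thetaSeries z q = z ^ m * q ^ (m ^ 2) * thetaSeries (z⁻¹ * q ^ (-(2 * m))) q := by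
  rw [thetaSeries, ← (Equiv.subLeft m).tsum_eq, thetaSeries, ← tsum_mul_left]
  refine tsum_congr fun k => ?_
  rw [Equiv.subLeft_apply, show (m - k) ^ 2 = m ^ 2 + (k ^ 2 + -(2 * m) * k) by ring,
    zpow_add₀ hq0, zpow_add₀ hq0, zpow_mul, zpow_sub₀ hz, mul_zpow, inv_zpow]
  ring

theorem thetaSeries_inv {z q : ℂ} (hz : z ≠ 0) (hq0 : q ≠ 0) :
    thetaSeries z⁻¹ q = thetaSeries z q := by
  simpa using (thetaSeries_reflect hz hq0 0).symm

/-! ### Products of theta series split along sublattices of ℤ² -/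

theorem hasSum_thetaSeries_mul {z w q : ℂ} (hz : z ≠ 0) (hw : w ≠ 0) (hq0 : q ≠ 0)
    (hq : ‖q‖ < 1) :
    HasSum (fun p : ℤ × ℤ => (q ^ (p.1 ^ 2) * z ^ p.1) * (q ^ (p.2 ^ 2) * w ^ p.2))
      (thetaSeries z q * thetaSeries w q) := by
  have hs := (summable_thetaSeries hz hq0 hq).norm
  have ht := (summable_thetaSeries hw hq0 hq).norm
  have h := (summable_mul_of_summable_norm hs ht).hasSum
  rwa [← tsum_mul_tsum_of_summable_norm hs ht] at h

/-- A sum over the lattice `ℤ²` split along the cosets of an index `m` sublattice. -/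
theorem hasSum_cosets {m : ℕ} {f : ℤ × ℤ → ℂ} {s : ℂ} (hf : HasSum f s)
    (e : Fin m × (ℤ × ℤ) ≃ ℤ × ℤ) {g : Fin m → ℂ}
    (hg : ∀ c, HasSum (fun p => f (e (c, p))) (g c)) : s = ∑ c, g c := by
  have h := (e.hasSum_iff.2 hf).prod_fiberwise hg
  exact h.unique (hasSum_fintype g)

/-- The cosets of the sublattice spanned by `(2, 1)` and `(1, -2)`. -/
def cosetEquivFive : Fin 5 × (ℤ × ℤ) ≃ ℤ × ℤ where
  toFun p := (2 * p.2.1 + p.2.2 + p.1, p.2.1 - 2 * p.2.2)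
  invFun p := (⟨((p.1 - 2 * p.2) % 5).toNat, by omega⟩,
    (p.2 + 2 * ((p.1 - 2 * p.2) / 5), (p.1 - 2 * p.2) / 5))
  left_inv := by
    rintro ⟨⟨c, hc⟩, y, n⟩
    simp only [Prod.mk.injEq, Fin.mk.injEq]
    omega
  right_inv := by
    rintro ⟨x, y⟩
    simp only [Prod.mk.injEq]
    omega

/-- The cosets of the sublattice spanned by `(1, 1)` and `(1, -1)`. -/
def cosetEquivTwo : Fin 2 × (ℤ × ℤ) ≃ ℤ × ℤ where
  toFun p := (p.2.1 + p.2.2 + p.1, p.2.1 - p.2.2)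
  invFun p := (⟨((p.1 - p.2) % 2).toNat, by omega⟩,
    (p.2 + (p.1 - p.2) / 2, (p.1 - p.2) / 2))
  left_inv := by
    rintro ⟨⟨c, hc⟩, y, n⟩
    simp only [Prod.mk.injEq, Fin.mk.injEq]
    omega
  right_inv := by
    rintro ⟨x, y⟩
    simp only [Prod.mk.injEq]
    omega

theorem thetaSeries_sq_eq {ω q : ℂ} (hω : ω ^ 2 = 1) (hq0 : q ≠ 0) (hq : ‖q‖ < 1) :
    thetaSeries ω q ^ 2 =
      thetaSeries 1 (q ^ 2) ^ 2 + ω * q * thetaSeries (q ^ 2) (q ^ 2) ^ 2 := by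
  have hω0 : ω ≠ 0 := by rintro rfl; simp at hω
  have hq2 : ‖q ^ 2‖ < 1 := by
    rw [norm_pow]; exact pow_lt_one₀ (norm_nonneg _) hq (by simp)
  have hq20 : q ^ 2 ≠ 0 := pow_ne_zero _ hq0
  have key := hasSum_cosets (hasSum_thetaSeries_mul hω0 hω0 hq0 hq) cosetEquivTwo
    (g := fun c => ω ^ (c : ℕ) * q ^ ((c : ℕ) ^ 2) *
      (thetaSeries ((q ^ 2) ^ (c : ℕ)) (q ^ 2) * thetaSeries ((q ^ 2) ^ (c : ℕ)) (q ^ 2)))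
    (fun c => by
      refine ((hasSum_thetaSeries_mul (pow_ne_zero _ hq20) (pow_ne_zero _ hq20) hq20
        hq2).mul_left _).congr_fun ?_
      rintro ⟨y, n⟩
      simp only [cosetEquivTwo, Equiv.coe_fn_mk]
      rw [mul_mul_mul_comm, ← zpow_add₀ hq0, ← zpow_add₀ hω0,
        show (y + n + ((c : ℕ) : ℤ)) ^ 2 + (y - n) ^ 2 =
          2 * y ^ 2 + 2 * n ^ 2 + ((c : ℕ) ^ 2 : ℕ) + 2 * (c : ℕ) * y + 2 * (c : ℕ) * n by
            push_cast; ring,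
        show y + n + ((c : ℕ) : ℤ) + (y - n) = 2 * y + (c : ℕ) by ring,
        zpow_add₀ hω0, zpow_mul ω 2 y, zpow_ofNat ω 2, hω, one_zpow, zpow_natCast]
      simp only [zpow_add₀ hq0, zpow_mul, zpow_ofNat, zpow_natCast]
      ring)
  rw [pow_two, key, Fin.sum_univ_two]
  simp
  ring

theorem thetaSeries_mul_eq {ω q : ℂ} (hω : ω ^ 5 = 1) (hq0 : q ≠ 0) (hq : ‖q‖ < 1) :
    thetaSeries ω q * thetaSeries (ω ^ 2) q =
      thetaSeries 1 (q ^ 5) ^ 2 + (ω + ω ^ 2 + ω ^ 3 + ω ^ 4) *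
        (q * (thetaSeries (q ^ 4) (q ^ 5) * thetaSeries (q ^ 2) (q ^ 5))) := by
  have hω0 : ω ≠ 0 := by rintro rfl; simp at hω
  have hω20 : ω ^ 2 ≠ 0 := pow_ne_zero _ hω0
  have hq5 : ‖q ^ 5‖ < 1 := by
    rw [norm_pow]; exact pow_lt_one₀ (norm_nonneg _) hq (by simp)
  have hq50 : q ^ 5 ≠ 0 := pow_ne_zero _ hq0
  -- With ω⁻² in place of ω² the weight is ω^(x - 2y), and x - 2y is constant modulo 5 on each
  -- coset. By reflection the four nontrivial cosets all give the same theta product.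
  have key := hasSum_cosets (hasSum_thetaSeries_mul hω0 (inv_ne_zero hω20) hq0 hq) cosetEquivFive
    (g := fun c => ω ^ (c : ℕ) * q ^ ((c : ℕ) ^ 2) *
      (thetaSeries (q ^ (4 * (c : ℕ))) (q ^ 5) * thetaSeries (q ^ (2 * (c : ℕ))) (q ^ 5)))
    (fun c => by
      refine ((hasSum_thetaSeries_mul (pow_ne_zero _ hq0) (pow_ne_zero _ hq0) hq50
        hq5).mul_left _).congr_fun ?_
      rintro ⟨y, n⟩
      simp only [cosetEquivFive, Equiv.coe_fn_mk]
      rw [mul_mul_mul_comm, ← zpow_add₀ hq0, ← zpow_natCast ω 2, ← zpow_neg, ← zpow_mul,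
        ← zpow_add₀ hω0,
        show (2 * y + n + ((c : ℕ) : ℤ)) ^ 2 + (y - 2 * n) ^ 2 =
          5 * y ^ 2 + 5 * n ^ 2 + ((c : ℕ) ^ 2 : ℕ) + 4 * (c : ℕ) * y + 2 * (c : ℕ) * n by
            push_cast; ring,
        show 2 * y + n + ((c : ℕ) : ℤ) + -((2 : ℕ) : ℤ) * (y - 2 * n) = 5 * n + (c : ℕ) by
          push_cast; ring,
        zpow_add₀ hω0, zpow_mul ω 5 n, zpow_ofNat ω 5, hω, one_zpow, zpow_natCast]
      simp only [zpow_add₀ hq0, zpow_mul, zpow_ofNat, zpow_natCast, pow_mul]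
      ring)
  have r1 : thetaSeries (q ^ 8) (q ^ 5) = (q ^ 3)⁻¹ * thetaSeries (q ^ 2) (q ^ 5) := by
    have h : (q ^ 8)⁻¹ * (q ^ 5) ^ (-(2 * (-1)) : ℤ) = q ^ 2 := by
      norm_num [zpow_ofNat]; field_simp
    rw [thetaSeries_reflect (pow_ne_zero 8 hq0) hq50 (-1), h]
    congr 1; norm_num [zpow_neg, zpow_ofNat]; field_simp
  have r2 : thetaSeries (q ^ 12) (q ^ 5) = (q ^ 7)⁻¹ * thetaSeries (q ^ 2) (q ^ 5) := by
    have h : (q ^ 12)⁻¹ * (q ^ 5) ^ (-(2 * (-1)) : ℤ) = (q ^ 2)⁻¹ := by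
      norm_num [zpow_ofNat]; field_simp
    rw [thetaSeries_reflect (pow_ne_zero 12 hq0) hq50 (-1), h, thetaSeries_inv (pow_ne_zero 2 hq0) hq50]
    congr 1; norm_num [zpow_neg, zpow_ofNat]; field_simp
  have r3 : thetaSeries (q ^ 6) (q ^ 5) = q⁻¹ * thetaSeries (q ^ 4) (q ^ 5) := by
    have h : (q ^ 6)⁻¹ * (q ^ 5) ^ (-(2 * (-1)) : ℤ) = q ^ 4 := by
      norm_num [zpow_ofNat]; field_simp
    rw [thetaSeries_reflect (pow_ne_zero 6 hq0) hq50 (-1), h]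
    congr 1; norm_num [zpow_neg, zpow_ofNat]; field_simp
  have r4 : thetaSeries (q ^ 16) (q ^ 5) = (q ^ 12)⁻¹ * thetaSeries (q ^ 4) (q ^ 5) := by
    have h : (q ^ 16)⁻¹ * (q ^ 5) ^ (-(2 * (-2)) : ℤ) = q ^ 4 := by
      norm_num [zpow_ofNat]; field_simp
    rw [thetaSeries_reflect (pow_ne_zero 16 hq0) hq50 (-2), h]
    congr 1; norm_num [zpow_neg, zpow_ofNat]; field_simp
  rw [← thetaSeries_inv hω20 hq0, key, Fin.sum_univ_five]
  simp only [Fin.isValue, Fin.coe_ofNat_eq_mod, Nat.reduceMod, Nat.reduceMul, Nat.reducePow, r1,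
    r2, r3, r4, pow_zero, pow_one]
  field_simp
  ring

/-! ### The modular equation of degree five for χ -/

theorem ramanujanChi_ne_zero {q : ℂ} (hq : ‖q‖ < 1) : ramanujanChi q ≠ 0 :=
  qShiftedFactorial_ne_zero_of_norm_lt_one
    (by rw [norm_pow]; exact pow_lt_one₀ (norm_nonneg _) hq (by simp)) (by simpa using hq)

theorem thetaSeries_one {q : ℂ} (hq0 : q ≠ 0) (hq : ‖q‖ < 1) :
    thetaSeries 1 q = qShiftedFactorial (q ^ 2) (q ^ 2) * ramanujanChi q ^ 2 := by
  rw [thetaSeries_eq one_ne_zero hq0 hq, ramanujanChi]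
  simp [pow_two]

/-- By the triple product the two series contribute the residues 1, 9, 3, 7 modulo 10 of the
exponents in χ(q); χ(q⁵) supplies the missing residue 5. -/
theorem theta_five_sub {q : ℂ} (hq0 : q ≠ 0) (hq : ‖q‖ < 1) :
    thetaSeries (q ^ 4) (q ^ 5) * thetaSeries (q ^ 2) (q ^ 5) * ramanujanChi (q ^ 5) =
      qShiftedFactorial (q ^ 10) (q ^ 10) ^ 2 * ramanujanChi q := by
  have hq5 : ‖q ^ 5‖ < 1 := by
    rw [norm_pow]; exact pow_lt_one₀ (norm_nonneg _) hq (by simp)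
  have hq2 : ‖q ^ 2‖ < 1 := by
    rw [norm_pow]; exact pow_lt_one₀ (norm_nonneg _) hq (by simp)
  have hq50 : q ^ 5 ≠ 0 := pow_ne_zero _ hq0
  rw [thetaSeries_eq (pow_ne_zero _ hq0) hq50 hq5, thetaSeries_eq (pow_ne_zero _ hq0) hq50 hq5,
    ramanujanChi, ramanujanChi, qShiftedFactorial_dissection (-q) hq2 (m := 5) (by simp)]
  simp only [Finset.prod_range_succ, Finset.prod_range_zero]
  have h1 : (q ^ 4)⁻¹ * q ^ 5 = q := by field_simp
  have h2 : (q ^ 2)⁻¹ * q ^ 5 = q ^ 3 := by field_simp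
  rw [h1, h2]
  ring_nf

/-- The two series contribute the factors twisted by the four nontrivial fifth roots of unity, and
χ(q) the untwisted one. -/
theorem theta_five_rootsOfUnity {ζ q : ℂ} (hζ : IsPrimitiveRoot ζ 5) (hq0 : q ≠ 0)
    (hq : ‖q‖ < 1) :
    thetaSeries ζ q * thetaSeries (ζ ^ 2) q * ramanujanChi q =
      qShiftedFactorial (q ^ 2) (q ^ 2) ^ 2 * ramanujanChi (q ^ 5) := by
  have hq2 : ‖q ^ 2‖ < 1 := by
    rw [norm_pow]; exact pow_lt_one₀ (norm_nonneg _) hq (by simp)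
  have hζ0 : ζ ≠ 0 := hζ.ne_zero (by simp)
  have h := prod_qShiftedFactorial_rootsOfUnity hζ (by simp) (-q) hq2
  simp only [Finset.prod_range_succ, Finset.prod_range_zero] at h
  have h1 : ζ⁻¹ = ζ ^ 4 := inv_eq_of_mul_eq_one_right (by rw [← pow_succ', hζ.pow_eq_one])
  have h2 : (ζ ^ 2)⁻¹ = ζ ^ 3 := inv_eq_of_mul_eq_one_right (by rw [← pow_add, hζ.pow_eq_one])
  rw [thetaSeries_eq hζ0 hq0 hq, thetaSeries_eq (pow_ne_zero _ hζ0) hq0 hq, h1, h2,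
    ramanujanChi, ramanujanChi, ← pow_mul, mul_comm 5 2, pow_mul, show -q ^ 5 = (-q) ^ 5 by ring,
    ← h]
  ring_nf

/-- The modular equation of degree five relating `χ(q)` and `χ(q⁵)`. -/
theorem ramanujanChi_modular_equation_five {q : ℂ} (hq0 : q ≠ 0) (hq : ‖q‖ < 1) :
    ramanujanChi q ^ 5 * ramanujanChi (q ^ 5) ^ 5 =
      q * ramanujanChi q ^ 6 + ramanujanChi (q ^ 5) ^ 6 +
        4 * q * ramanujanChi q * ramanujanChi (q ^ 5) := by
  have hq5 : ‖q ^ 5‖ < 1 := by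
    rw [norm_pow]; exact pow_lt_one₀ (norm_nonneg _) hq (by simp)
  have hq2 : ‖q ^ 2‖ < 1 := by
    rw [norm_pow]; exact pow_lt_one₀ (norm_nonneg _) hq (by simp)
  have hq10 : ‖q ^ 10‖ < 1 := by
    rw [norm_pow]; exact pow_lt_one₀ (norm_nonneg _) hq (by simp)
  have hζ := Complex.isPrimitiveRoot_exp 5 (by simp)
  set ζ := Complex.exp (2 * Real.pi * Complex.I / (5 : ℕ))
  have hsum : 1 + ζ + ζ ^ 2 + ζ ^ 3 + ζ ^ 4 = 0 := by
    have := hζ.geom_sum_eq_zero (by simp)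
    simpa [Finset.sum_range_succ] using this
  have t1 := thetaSeries_mul_eq (one_pow 5) hq0 hq
  have t2 := thetaSeries_mul_eq hζ.pow_eq_one hq0 hq
  have p1 := theta_five_sub hq0 hq
  have p2 := theta_five_rootsOfUnity hζ hq0 hq
  have f1 := thetaSeries_one hq0 hq
  have f2 := thetaSeries_one (pow_ne_zero 5 hq0) hq5
  rw [← pow_mul] at f2
  norm_num at t1 f2
  rw [f1, f2] at t1
  rw [f2] at t2
  have ha := ramanujanChi_ne_zero hq
  have hb := ramanujanChi_ne_zero hq5
  have hE2 : qShiftedFactorial (q ^ 2) (q ^ 2) ≠ 0 :=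
    qShiftedFactorial_ne_zero_of_norm_lt_one hq2 hq2
  have hE10 : qShiftedFactorial (q ^ 10) (q ^ 10) ≠ 0 :=
    qShiftedFactorial_ne_zero_of_norm_lt_one hq10 hq10
  generalize ramanujanChi q = a at *
  generalize ramanujanChi (q ^ 5) = b at *
  generalize qShiftedFactorial (q ^ 2) (q ^ 2) = E at *
  generalize qShiftedFactorial (q ^ 10) (q ^ 10) = F at *
  generalize thetaSeries (q ^ 4) (q ^ 5) * thetaSeries (q ^ 2) (q ^ 5) = S at *
  generalize thetaSeries ζ q * thetaSeries (ζ ^ 2) q = Z at *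
  have t2' : Z = (F * b ^ 2) ^ 2 - q * S := by linear_combination t2 + q * S * hsum
  have i1 : E ^ 2 * a ^ 4 * b = F ^ 2 * (b ^ 5 + 4 * q * a) := by
    linear_combination b * t1 + 4 * q * p1
  have i2 : F ^ 2 * (5 * a * b ^ 4) = E ^ 2 * (a ^ 5 + 4 * b) := by
    linear_combination 4 * p2 - a * t1 - 4 * a * t2'
  have hEF : E ^ 2 * F ^ 2 ≠ 0 := mul_ne_zero (pow_ne_zero 2 hE2) (pow_ne_zero 2 hE10)
  -- Multiplying `i1` by `i2` makes E²F² a common factor: 5a⁵b⁵ = (b⁵ + 4qa)(a⁵ + 4b).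
  have h : E ^ 2 * F ^ 2 * (4 * (a ^ 5 * b ^ 5)) = E ^ 2 * F ^ 2 *
      (4 * (q * a ^ 6 + b ^ 6 + 4 * q * a * b)) := by
    linear_combination F ^ 2 * (5 * a * b ^ 4) * i1 + F ^ 2 * (b ^ 5 + 4 * q * a) * i2
  exact mul_left_cancel₀ (by norm_num : (4 : ℂ) ≠ 0) (mul_left_cancel₀ hEF h)

/-! ### Theta inversion and the value of χ at exp(-π) -/

theorem thetaSeries_one_inversion {a : ℂ} (ha : 0 < a.re) :
    a * thetaSeries 1 (Complex.exp (-Real.pi * a)) ^ 2 =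
      thetaSeries 1 (Complex.exp (-Real.pi / a)) ^ 2 := by
  have h (b : ℂ) : thetaSeries 1 (Complex.exp b) = ∑' n : ℤ, Complex.exp (b * (n : ℂ) ^ 2) := by
    refine tsum_congr fun n => ?_
    rw [one_zpow, mul_one, ← Complex.exp_int_mul]
    push_cast
    ring_nf
  have ha0 : a ≠ 0 := by rintro rfl; simp at ha
  have hsq : (a ^ (1 / 2 : ℂ)) ^ 2 = a := by
    rw [← Complex.cpow_nat_mul]; simp
  rw [h, h, Complex.tsum_exp_neg_mul_int_sq ha, mul_pow, div_pow, hsq]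
  field_simp

theorem qShiftedFactorial_sq {a q : ℂ} (hq : ‖q‖ < 1) :
    qShiftedFactorial a q * qShiftedFactorial (-a) q = qShiftedFactorial (a ^ 2) (q ^ 2) := by
  have hζ : IsPrimitiveRoot (-1 : ℂ) 2 := IsPrimitiveRoot.neg_one 0 (by simp)
  simpa [Finset.prod_range_succ] using prod_qShiftedFactorial_rootsOfUnity hζ two_pos a hq

theorem thetaSeries_neg_one {q : ℂ} (hq0 : q ≠ 0) (hq : ‖q‖ < 1) :
    thetaSeries (-1) q = qShiftedFactorial (q ^ 2) (q ^ 2) * qShiftedFactorial q (q ^ 2) ^ 2 := by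
  rw [thetaSeries_eq (by simp) hq0 hq]
  norm_num [pow_two]

theorem thetaSeries_self {q : ℂ} (hq0 : q ≠ 0) (hq : ‖q‖ < 1) :
    thetaSeries q q =
      2 * (qShiftedFactorial (q ^ 2) (q ^ 2) * qShiftedFactorial (-q ^ 2) (q ^ 2) ^ 2) := by
  have hq2 : ‖q ^ 2‖ < 1 := by
    rw [norm_pow]; exact pow_lt_one₀ (norm_nonneg _) hq (by simp)
  rw [thetaSeries_eq hq0 hq0 hq, inv_mul_cancel₀ hq0, qShiftedFactorial_eq_mul (-1) hq2]
  ring_nf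

theorem ramanujanChi_exp_neg_pi :
    ramanujanChi (Complex.exp (-Real.pi)) ^ 24 = 64 * Complex.exp (-Real.pi) := by
  obtain ⟨p, hp⟩ : ∃ p : ℂ, p = Complex.exp (-Real.pi / 2) := ⟨_, rfl⟩
  have hpq : Complex.exp (-Real.pi) = p ^ 2 := by
    rw [hp, ← Complex.exp_nat_mul]; push_cast; ring_nf
  have hpq2 : Complex.exp (-Real.pi * 2) = (p ^ 2) ^ 2 := by
    rw [← hpq, ← Complex.exp_nat_mul]; push_cast; ring_nf
  -- Inversion links the nomes q² and p = q^(1/2), and the squaring formulas bring both back to q.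
  have hinv := thetaSeries_one_inversion (a := 2) (by simp)
  rw [hpq2, ← hp] at hinv
  rw [hpq]
  have hp0 : p ≠ 0 := hp ▸ Complex.exp_ne_zero _
  have hp1 : ‖p‖ < 1 := by
    rw [hp, Complex.norm_exp]
    have := Real.pi_pos
    simp
    linarith
  clear hp hpq hpq2
  obtain ⟨q, hq⟩ : ∃ q : ℂ, q = p ^ 2 := ⟨_, rfl⟩
  have hq1 : ‖q‖ < 1 := by
    rw [hq, norm_pow]; exact pow_lt_one₀ (norm_nonneg _) hp1 (by simp)
  have hq2 : ‖q ^ 2‖ < 1 := by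
    rw [norm_pow]; exact pow_lt_one₀ (norm_nonneg _) hq1 (by simp)
  have hq0 : q ≠ 0 := hq ▸ pow_ne_zero _ hp0
  have s1 := thetaSeries_sq_eq (one_pow 2) hp0 hp1
  have s2 := thetaSeries_sq_eq neg_one_sq hp0 hp1
  have s3 := thetaSeries_sq_eq (one_pow 2) hq0 hq1
  have s4 := thetaSeries_sq_eq neg_one_sq hq0 hq1
  rw [← hq] at s1 s2 hinv ⊢
  have m1 := thetaSeries_one hp0 hp1
  have m2 := thetaSeries_neg_one hp0 hp1
  have m3 := thetaSeries_one hq0 hq1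
  have m4 := thetaSeries_neg_one hq0 hq1
  have m5 := thetaSeries_self hq0 hq1
  have c1 : qShiftedFactorial p q * ramanujanChi p = qShiftedFactorial q (q ^ 2) := by
    rw [ramanujanChi, ← hq, qShiftedFactorial_sq hq1, hq]
  have c2 : qShiftedFactorial q q =
      qShiftedFactorial q (q ^ 2) * qShiftedFactorial (q ^ 2) (q ^ 2) := by
    rw [qShiftedFactorial_dissection q hq1 (m := 2) (by simp)]
    simp [Finset.prod_range_succ, pow_two]
  -- Euler's identity (q; q²)(-q; q²)(-q²; q²) = 1, the last two bases being q² as well.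
  have c3 : qShiftedFactorial q (q ^ 2) * ramanujanChi q *
      qShiftedFactorial (-q ^ 2) (q ^ 2) = 1 := by
    rw [ramanujanChi, qShiftedFactorial_sq hq2]
    have d1 := qShiftedFactorial_dissection (q ^ 2) hq2 (m := 2) (by simp)
    have d2 := qShiftedFactorial_sq (a := q ^ 2) hq2
    have hne : qShiftedFactorial (q ^ 2) (q ^ 2) ≠ 0 :=
      qShiftedFactorial_ne_zero_of_norm_lt_one hq2 hq2
    simp only [Finset.prod_range_succ, Finset.prod_range_zero, one_mul, pow_zero, mul_one,
      pow_one, ← pow_two] at d1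
    rw [← d2] at d1
    refine mul_left_cancel₀ hne ?_
    linear_combination -d1
  have hE : qShiftedFactorial (q ^ 2) (q ^ 2) ≠ 0 :=
    qShiftedFactorial_ne_zero_of_norm_lt_one hq2 hq2
  rw [← hq] at m1 m2
  generalize qShiftedFactorial (q ^ 2) (q ^ 2) = E at *
  generalize qShiftedFactorial q (q ^ 2) = y at *
  generalize qShiftedFactorial (-q ^ 2) (q ^ 2) = h at *
  generalize qShiftedFactorial q q = D at *
  generalize ramanujanChi q = x at *
  -- `θ₂² = θ₄²` at `q = exp (-π)`
  have e1 : thetaSeries (-1) q ^ 2 = p * thetaSeries q q ^ 2 := by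
    linear_combination s4 + s3 + s1 + hinv
  -- Jacobi's identity
  have e2 : thetaSeries 1 p * thetaSeries (-1) p = thetaSeries (-1) q ^ 2 := by
    rw [m1, m2, m4, c2, ← c1]; ring
  have e3 : (thetaSeries 1 q ^ 2) ^ 2 = 2 * (thetaSeries (-1) q ^ 2) ^ 2 := by
    have : thetaSeries 1 p ^ 2 * thetaSeries (-1) p ^ 2 = (thetaSeries (-1) q ^ 2) ^ 2 := by
      rw [← e2]; ring
    rw [s1, s2] at this
    linear_combination this - (thetaSeries (-1) q ^ 2 + p * thetaSeries q q ^ 2) * e1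
  have e4 : x ^ 8 = 2 * y ^ 8 := by
    rw [m3, m4] at e3
    refine mul_left_cancel₀ (pow_ne_zero 4 hE) ?_
    linear_combination e3
  have e5 : y ^ 4 = 4 * p * h ^ 4 := by
    rw [m4, m5] at e1
    refine mul_left_cancel₀ (pow_ne_zero 2 hE) ?_
    linear_combination e1
  have e6 : y ^ 16 * x ^ 8 = 16 * q := by
    have : y ^ 8 * x ^ 8 * h ^ 8 = 1 := by rw [← mul_pow, ← mul_pow, c3, one_pow]
    calc y ^ 16 * x ^ 8 = (y ^ 4) ^ 2 * (y ^ 8 * x ^ 8) := by ring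
      _ = 16 * p ^ 2 * (y ^ 8 * x ^ 8 * h ^ 8) := by rw [e5]; ring
      _ = 16 * q := by rw [this, hq, mul_one]
  calc x ^ 24 = (x ^ 8) ^ 2 * x ^ 8 := by ring
    _ = 4 * (y ^ 16 * x ^ 8) := by rw [e4]; ring
    _ = 64 * q := by rw [e6]; ring

/-! ### Real class invariants -/

theorem exists_ofReal_ramanujanChi {q : ℝ} (hq0 : 0 < q) (hq1 : q < 1) :
    ∃ c : ℝ, 1 ≤ c ∧ ramanujanChi (q : ℂ) = c := by
  have hq2 : ‖(q : ℂ) ^ 2‖ < 1 := by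
    rw [norm_pow, Complex.norm_real, Real.norm_of_nonneg hq0.le]
    exact pow_lt_one₀ hq0.le hq1 (by simp)
  have hcl : IsClosed (((↑) : ℝ → ℂ) '' Set.Ici 1) :=
    Complex.isometry_ofReal.isClosedEmbedding.isClosedMap _ isClosed_Ici
  have hmem (n : ℕ) : ∏ k ∈ Finset.range n, (1 - -(q : ℂ) * ((q : ℂ) ^ 2) ^ k) ∈
      ((↑) : ℝ → ℂ) '' Set.Ici 1 := by
    refine ⟨∏ k ∈ Finset.range n, (1 + q * (q ^ 2) ^ k), ?_, by push_cast; simp⟩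
    refine Finset.prod_induction _ (fun x : ℝ => 1 ≤ x) (fun _ _ => one_le_mul_of_one_le_of_one_le) le_rfl
      fun k _ => ?_
    have : 0 ≤ q * (q ^ 2) ^ k := by positivity
    linarith
  obtain ⟨c, hc, h⟩ := hcl.mem_of_tendsto (tendsto_prod_qShiftedFactorial (-(q : ℂ)) hq2)
    (Eventually.of_forall hmem)
  exact ⟨c, hc, h.symm⟩

/-- The Weber function `2^(-1/4) q^(-1/24) χ(q)` at `q = exp (-π t)`, as a real number. -/
noncomputable def realClassInvariant (t : ℝ) : ℝ :=
  (2 : ℝ) ^ (-(1 / 4) : ℝ) * Real.exp (-Real.pi * t) ^ (-(1 / 24) : ℝ) *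
    (ramanujanChi ((Real.exp (-Real.pi * t) : ℝ) : ℂ)).re

theorem exp_neg_pi_mul_lt_one {t : ℝ} (ht : 0 < t) : Real.exp (-Real.pi * t) < 1 := by
  rw [Real.exp_lt_one_iff]
  nlinarith [Real.pi_pos]

theorem ofReal_re_ramanujanChi {t : ℝ} (ht : 0 < t) :
    (((ramanujanChi ((Real.exp (-Real.pi * t) : ℝ) : ℂ)).re : ℝ) : ℂ) =
      ramanujanChi ((Real.exp (-Real.pi * t) : ℝ) : ℂ) := by
  obtain ⟨c, -, h⟩ := exists_ofReal_ramanujanChi (Real.exp_pos _) (exp_neg_pi_mul_lt_one ht)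
  rw [h, Complex.ofReal_re]

theorem one_le_re_ramanujanChi {t : ℝ} (ht : 0 < t) :
    1 ≤ (ramanujanChi ((Real.exp (-Real.pi * t) : ℝ) : ℂ)).re := by
  obtain ⟨c, hc, h⟩ := exists_ofReal_ramanujanChi (Real.exp_pos _) (exp_neg_pi_mul_lt_one ht)
  rwa [h, Complex.ofReal_re]

theorem classInvariantG_eq_ofReal {n : ℚ} (hn : 0 < n) :
    classInvariantG n = (realClassInvariant √(n : ℝ) : ℂ) := by
  have ht : 0 < √(n : ℝ) := Real.sqrt_pos.2 (by exact_mod_cast hn)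
  rw [classInvariantG, realClassInvariant, Complex.ofReal_mul (_ * _) (Complex.re _),
    ofReal_re_ramanujanChi ht]

theorem realClassInvariant_pos {t : ℝ} (ht : 0 < t) : 0 < realClassInvariant t := by
  have := one_le_re_ramanujanChi ht
  unfold realClassInvariant
  have h0 : 0 < (ramanujanChi ((Real.exp (-Real.pi * t) : ℝ) : ℂ)).re := by linarith
  exact mul_pos (mul_pos (Real.rpow_pos_of_pos two_pos _)
    (Real.rpow_pos_of_pos (Real.exp_pos _) _)) h0

theorem two_rpow_neg_quarter_pow : ((2 : ℝ) ^ (-(1 / 4) : ℝ)) ^ 4 = 1 / 2 := by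
  rw [← Real.rpow_mul_natCast two_pos.le]
  norm_num [Real.rpow_neg_one]

theorem exp_rpow_pow (t : ℝ) :
    (Real.exp (-Real.pi * t) ^ (-(1 / 24) : ℝ)) ^ 24 * Real.exp (-Real.pi * t) = 1 := by
  rw [← Real.rpow_mul_natCast (Real.exp_pos _).le]
  norm_num [Real.rpow_neg_one, Real.exp_ne_zero]

theorem realClassInvariant_one : realClassInvariant 1 = 1 := by
  have h : realClassInvariant 1 ^ 24 = 1 := by
    have hx : (ramanujanChi ((Real.exp (-Real.pi * 1) : ℝ) : ℂ)).re ^ 24 =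
        64 * Real.exp (-Real.pi * 1) := by
      have := ramanujanChi_exp_neg_pi
      rw [← Complex.ofReal_inj]
      rw [Complex.ofReal_pow, ofReal_re_ramanujanChi one_pos]
      push_cast
      simpa using this
    rw [realClassInvariant, mul_pow, mul_pow, hx]
    have h2 := two_rpow_neg_quarter_pow
    have h3 := exp_rpow_pow 1
    calc ((2 : ℝ) ^ (-(1 / 4) : ℝ)) ^ 24 * (Real.exp (-Real.pi * 1) ^ (-(1 / 24) : ℝ)) ^ 24 *
          (64 * Real.exp (-Real.pi * 1))
        = 64 * (((2 : ℝ) ^ (-(1 / 4) : ℝ)) ^ 4) ^ 6 *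
          ((Real.exp (-Real.pi * 1) ^ (-(1 / 24) : ℝ)) ^ 24 * Real.exp (-Real.pi * 1)) := by ring
      _ = 1 := by rw [h2, h3]; norm_num
  exact (pow_eq_one_iff_of_nonneg (realClassInvariant_pos one_pos).le (by simp)).1 h

/-- The modular equation of degree five for class invariants. -/
theorem realClassInvariant_modular_equation_five {t : ℝ} (ht : 0 < t) :
    realClassInvariant t ^ 6 + realClassInvariant (5 * t) ^ 6 =
      2 * (realClassInvariant t ^ 5 * realClassInvariant (5 * t) ^ 5 -
        realClassInvariant t * realClassInvariant (5 * t)) := by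
  have hexp : Real.exp (-Real.pi * (5 * t)) = Real.exp (-Real.pi * t) ^ 5 := by
    rw [← Real.exp_nat_mul]; push_cast; ring_nf
  have hmod := ramanujanChi_modular_equation_five
    (q := ((Real.exp (-Real.pi * t) : ℝ) : ℂ)) (by simp) (by
      rw [Complex.norm_real, Real.norm_of_nonneg (Real.exp_pos _).le]
      exact exp_neg_pi_mul_lt_one ht)
  rw [← Complex.ofReal_pow, ← hexp, ← ofReal_re_ramanujanChi ht,
    ← ofReal_re_ramanujanChi (by positivity : 0 < 5 * t)] at hmod
  norm_cast at hmod
  have hd5 : Real.exp (-Real.pi * (5 * t)) ^ (-(1 / 24) : ℝ) =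
      (Real.exp (-Real.pi * t) ^ (-(1 / 24) : ℝ)) ^ 5 := by
    rw [hexp, ← Real.rpow_natCast, ← Real.rpow_mul (Real.exp_pos _).le,
      ← Real.rpow_mul_natCast (Real.exp_pos _).le]
    push_cast; ring_nf
  have hc := two_rpow_neg_quarter_pow
  have hd := exp_rpow_pow t
  rw [realClassInvariant, realClassInvariant, hd5]
  generalize (ramanujanChi ((Real.exp (-Real.pi * t) : ℝ) : ℂ)).re = a at *
  generalize (ramanujanChi ((Real.exp (-Real.pi * (5 * t)) : ℝ) : ℂ)).re = b at *
  generalize Real.exp (-Real.pi * t) ^ (-(1 / 24) : ℝ) = d at *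
  generalize (2 : ℝ) ^ (-(1 / 4) : ℝ) = c at *
  generalize Real.exp (-Real.pi * t) = q at *
  linear_combination (-c ^ 6 * d ^ 30) * hmod - (c ^ 6 * d ^ 6 * a ^ 6) * hd -
    2 * c ^ 6 * d ^ 30 * a ^ 5 * b ^ 5 * hc - 4 * c ^ 6 * d ^ 6 * a * b * hd -
    4 * c ^ 2 * d ^ 6 * a * b * hc

/-! ### The values G_25 and G_625 -/

theorem realClassInvariant_five : realClassInvariant 5 = Real.goldenRatio := by
  have h := realClassInvariant_modular_equation_five one_pos
  rw [mul_one, realClassInvariant_one] at h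
  have hv := realClassInvariant_pos (t := 5) (by norm_num)
  generalize realClassInvariant 5 = v at *
  have h2 : (v ^ 2 - v - 1) ^ 2 * (v ^ 2 + 1) = 0 := by linear_combination h
  have h3 : v ^ 2 - v - 1 = 0 := by
    rcases mul_eq_zero.1 h2 with h | h
    · exact pow_eq_zero_iff (two_ne_zero) |>.1 h
    · nlinarith [sq_nonneg v]
  have h4 : (v - Real.goldenRatio) * (v + Real.goldenRatio - 1) = 0 := by
    linear_combination h3 - Real.goldenRatio_sq
  rcases mul_eq_zero.1 h4 with h | h
  · linarith
  · linarith [Real.one_lt_goldenRatio]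

/-- Needed to discard the spurious root 1 of the sextic; crude bounds on the three factors suffice.
-/
theorem one_lt_realClassInvariant_twentyfive : 1 < realClassInvariant 25 := by
  have h1 := one_le_re_ramanujanChi (t := 25) (by norm_num)
  have h2 : (1 / 2 : ℝ) ≤ (2 : ℝ) ^ (-(1 / 4) : ℝ) := by
    have : (2 : ℝ) ^ (-1 : ℝ) ≤ (2 : ℝ) ^ (-(1 / 4) : ℝ) :=
      Real.rpow_le_rpow_of_exponent_le one_le_two (by norm_num)
    rw [Real.rpow_neg_one] at this
    linarith
  have h3 : 4 < Real.exp (-Real.pi * 25) ^ (-(1 / 24) : ℝ) := by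
    rw [← Real.exp_mul]
    have := Real.add_one_le_exp (-Real.pi * 25 * (-(1 / 24)))
    linarith [Real.pi_gt_three]
  unfold realClassInvariant
  generalize (ramanujanChi ((Real.exp (-Real.pi * 25) : ℝ) : ℂ)).re = a at *
  generalize Real.exp (-Real.pi * 25) ^ (-(1 / 24) : ℝ) = d at *
  generalize (2 : ℝ) ^ (-(1 / 4) : ℝ) = c at *
  have h4 : 1 < c * d := by nlinarith
  nlinarith

theorem realClassInvariant_twentyfive_quintic :
    let φ := Real.goldenRatio
    let v := realClassInvariant 25
    v ^ 5 - (10 * φ + 5) * (v ^ 4 + v ^ 3 + v ^ 2 + v) - (8 * φ + 5) = 0 := by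
  intro φ v
  have hφ : φ ^ 2 = φ + 1 := Real.goldenRatio_sq
  have h5 : φ ^ 5 = 5 * φ + 3 := by linear_combination (φ ^ 3 + φ ^ 2 + 2 * φ + 3) * hφ
  have h := realClassInvariant_modular_equation_five (t := 5) (by norm_num)
  rw [realClassInvariant_five, show (5 * 5 : ℝ) = 25 by norm_num] at h
  change φ ^ 6 + v ^ 6 = 2 * (φ ^ 5 * v ^ 5 - φ * v) at h
  have hv : v - 1 ≠ 0 := sub_ne_zero.2 one_lt_realClassInvariant_twentyfive.ne'
  refine mul_left_cancel₀ hv ?_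
  linear_combination h - (φ - 2 * v ^ 5) * h5 - 5 * hφ

/-- Dividing by v⁵ turns the equation into 1 = K(v⁻¹ + v⁻² + v⁻³ + v⁻⁴) + Mv⁻⁵, whose right side is
strictly decreasing. `key` is this comparison with denominators cleared. -/
theorem quintic_pos_root_unique {K M v w : ℝ} (hK : 0 < K) (hM : 0 < M) (hv : 0 < v) (hw : 0 < w)
    (h1 : v ^ 5 - K * (v ^ 4 + v ^ 3 + v ^ 2 + v) - M = 0)
    (h2 : w ^ 5 - K * (w ^ 4 + w ^ 3 + w ^ 2 + w) - M = 0) : v = w := by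
  have key : (w - v) * (K * (v ^ 4 * w ^ 4 + v ^ 3 * w ^ 3 * (v + w) +
      v ^ 2 * w ^ 2 * (v ^ 2 + v * w + w ^ 2) + v * w * (v ^ 3 + v ^ 2 * w + v * w ^ 2 + w ^ 3)) +
      M * (v ^ 4 + v ^ 3 * w + v ^ 2 * w ^ 2 + v * w ^ 3 + w ^ 4)) = 0 := by
    linear_combination v ^ 5 * h2 - w ^ 5 * h1
  rcases mul_eq_zero.1 key with h | h
  · linarith
  · exact absurd h (by positivity)

/-- Modulo φ² = φ + 1, the polynomial in w becomes one of degree ten in S divisible by the quintic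
for S; the coefficient of `hS` is the quotient. -/
theorem quintic_substitution {φ S : ℝ} (hφ : φ ^ 2 = φ + 1)
    (hS : S ^ 5 - 10 * φ * S ^ 3 + 20 * (φ + 1) * S - 24 * φ = 0) {w : ℝ}
    (hw : w = ((φ + 1) * (1 + S) ^ 2 - (5 * φ + 3)) / 2) :
    w ^ 5 - (10 * φ + 5) * (w ^ 4 + w ^ 3 + w ^ 2 + w) - (8 * φ + 5) = 0 := by
  subst hw
  linear_combination (49 + 317 / 4 * φ + (-525 / 8 - 425 / 4 * φ) * S +
      (-145 / 8 - 235 / 8 * φ) * S ^ 2 + (405 / 16 + 655 / 16 * φ) * S ^ 3 +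
      (85 / 8 + 275 / 16 * φ) * S ^ 4 + (17 / 16 + 55 / 32 * φ) * S ^ 5) * hS + (
      (6 - 1144 * φ - 592 * φ ^ 2 - 192 * φ ^ 3) +
      (965 + 3020 * φ + 1480 * φ ^ 2 + 400 * φ ^ 3) * S +
      (-1290 - 1540 * φ - 640 * φ ^ 2 - 120 * φ ^ 3) * S ^ 2 +
      (-715/2 - 1625 * φ - 790 * φ ^ 2 - 200 * φ ^ 3) * S ^ 3 +
      (1945/4 + 1085 * φ + 430 * φ ^ 2 + 80 * φ ^ 3) * S ^ 4 +
      (1047/4 + 2023/4 * φ + 457/2 * φ ^ 2 + 51 * φ ^ 3) * S ^ 5 +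
      (-35 - 1715/8 * φ - 305/4 * φ ^ 2 - 25/2 * φ ^ 3) * S ^ 6 +
      (-125/8 - 205/2 * φ - 40 * φ ^ 2 - 15/2 * φ ^ 3) * S ^ 7 +
      (395/16 + 25/8 * φ + 5/8 * φ ^ 2) * S ^ 8 +
      (165/16 + 85/16 * φ + 15/8 * φ ^ 2 + 5/16 * φ ^ 3) * S ^ 9 +
      (33/32 + 17/32 * φ + 3/16 * φ ^ 2 + 1/32 * φ ^ 3) * S ^ 10) * hφ

theorem corollary5p17 :
    classInvariantG 625 =
      (((11 + 5 * √(5 : ℝ)) / 4 *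
        (Real.tan (Real.pi / 5) ^ 2 / √(5 : ℝ) *
          (1 + (8 * (3 * Real.cos (Real.pi / 5) + Real.sin (Real.pi / 5))) ^ (1 / 5 : ℝ)
            + (8 * (3 * Real.cos (Real.pi / 5) - Real.sin (Real.pi / 5))) ^ (1 / 5 : ℝ)) ^ 2
          - 1) : ℝ) : ℂ) := by
  have hsqrt : √((625 : ℚ) : ℝ) = 25 := by
    rw [show ((625 : ℚ) : ℝ) = 25 ^ 2 by norm_num, Real.sqrt_sq (by norm_num)]
  rw [classInvariantG_eq_ofReal (by norm_num), hsqrt, Complex.ofReal_inj]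
  obtain ⟨φ, hφdef⟩ : ∃ φ, φ = Real.goldenRatio := ⟨_, rfl⟩
  have hφ : φ ^ 2 = φ + 1 := hφdef ▸ Real.goldenRatio_sq
  have hφ1 : 1 < φ := hφdef ▸ Real.one_lt_goldenRatio
  have h5 : √(5 : ℝ) = 2 * φ - 1 := by rw [hφdef, Real.goldenRatio]; ring
  have hcos : Real.cos (Real.pi / 5) = φ / 2 := by
    rw [Real.cos_pi_div_five, hφdef, Real.goldenRatio]; ring
  have hsin : Real.sin (Real.pi / 5) ^ 2 = 1 - φ ^ 2 / 4 := by
    rw [Real.sin_sq, hcos]; ring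
  have hsin1 := Real.sin_le_one (Real.pi / 5)
  have hsin0 := Real.neg_one_le_sin (Real.pi / 5)
  have htan : Real.tan (Real.pi / 5) ^ 2 / √(5 : ℝ) = 2 * φ - 3 := by
    have : 2 * φ - 1 ≠ 0 := by linarith
    rw [Real.tan_eq_sin_div_cos, div_pow, hsin, hcos, h5, div_eq_iff this,
      div_eq_iff (by positivity)]
    linear_combination (-φ ^ 2 + φ - 1) * hφ
  rw [htan, h5, hcos]
  generalize Real.sin (Real.pi / 5) = s at *
  have hroot : ∀ x : ℝ, 0 ≤ x → (x ^ (1 / 5 : ℝ)) ^ 5 = x := fun x hx => by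
    rw [← Real.rpow_mul_natCast hx]; norm_num
  have hx : 0 < 8 * (3 * (φ / 2) + s) := by linarith
  have hy : 0 < 8 * (3 * (φ / 2) - s) := by linarith
  have hA5 := hroot _ hx.le
  have hB5 := hroot _ hy.le
  have hA := Real.rpow_pos_of_pos hx (1 / 5)
  have hB := Real.rpow_pos_of_pos hy (1 / 5)
  generalize (8 * (3 * (φ / 2) + s)) ^ (1 / 5 : ℝ) = A at *
  generalize (8 * (3 * (φ / 2) - s)) ^ (1 / 5 : ℝ) = B at *
  have hAB : A * B = 2 * φ := by
    refine (pow_left_inj₀ (by positivity) (by positivity) (by norm_num : 5 ≠ 0)).1 ?_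
    rw [mul_pow, hA5, hB5]
    linear_combination -64 * hsin - (32 * φ ^ 3 + 32 * φ ^ 2 + 64 * φ - 64) * hφ
  -- De Moivre's quintic: A⁵ + B⁵ = S⁵ - 5PS³ + 5P²S with S = A + B and P = AB = 2φ.
  have hS : (A + B) ^ 5 - 10 * φ * (A + B) ^ 3 + 20 * (φ + 1) * (A + B) - 24 * φ = 0 := by
    linear_combination hA5 + hB5 + (5 * (A + B) ^ 3 - 5 * (A * B + 2 * φ) * (A + B)) * hAB -
      20 * (A + B) * hφ
  have hw : (11 + 5 * (2 * φ - 1)) / 4 * ((2 * φ - 3) * (1 + A + B) ^ 2 - 1) =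
      ((φ + 1) * (1 + (A + B)) ^ 2 - (5 * φ + 3)) / 2 := by
    linear_combination (5 * (1 + A + B) ^ 2) * hφ
  -- From (A + B)² ≥ 4AB = 8φ; this bound makes the closed form positive.
  have hS3 : 3 ≤ A + B := by
    nlinarith [sq_nonneg (A - B)]
  refine quintic_pos_root_unique (K := 10 * φ + 5) (M := 8 * φ + 5) (by positivity) (by positivity)
    (realClassInvariant_pos (by norm_num)) ?_ ?_ (quintic_substitution hφ hS hw)
  · rw [hw]
    nlinarith
  · rw [hφdef]
    exact realClassInvariant_twentyfive_quintic
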